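/- For a finite simplicial complex $X$ let $\Delta_{i,j}(X)$ denote the maximum, over the $i$-dimensional faces $\sigma$ of $X$, of the number of $j$-dimensional faces of $X$ containing $\sigma$, and let $\Delta(X)=\max_{i,j\ge 0}\Delta_{i,j}(X)$. For an abelian group $A$ let $A_T$ denote its torsion subgroup, and let $H_{k}(X)$ denote simplicial homology with integer coefficients. For every $d\ge 2$ there exists a constant $K$ (a positive integer depending only on $d$) such that both of the following hold. (1) For every integer $m\ge 2$ there is a $d$-dimensional simplicial complex $X$ on at most $K\log_2 m$ vertices with $\Delta(X)\le K-1$ and $H_{d-1}(X)_T\cong \mathbb{Z}/m\mathbb{Z}$. (2) For every nontrivial finite abelian group $G$ there is a $d$-dimensional simplicial complex $X$ on at most $K\log_2|G|$ vertices with $\Delta(X)\le K-1$ and $H_{d-1}(X)_T\cong G$. -/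

import Mathlib

namespace AbstractSimplicialComplex

section Combinatorics

variable {V : Type*}

/-- The set of `k`-dimensional faces, i.e. the faces with exactly `k + 1` vertices. -/
def skel (X : AbstractSimplicialComplex V) (k : ℕ) : Set (Finset V) :=
  {s | s ∈ X.faces ∧ s.card = k + 1}

/-- `X` is a `d`-dimensional complex: it has a `d`-dimensional face and no face of larger
dimension. -/
def IsOfDim (X : AbstractSimplicialComplex V) (d : ℕ) : Prop :=
  (X.skel d).Nonempty ∧ ∀ s ∈ X.faces, s.card ≤ d + 1

/-- `Δ_{i,j}(X)`: the maximum, over the `i`-dimensional faces `σ`, of the number of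
`j`-dimensional faces containing `σ`. -/
noncomputable def degree (X : AbstractSimplicialComplex V) (i j : ℕ) : ℕ∞ :=
  ⨆ σ ∈ X.skel i, {τ | τ ∈ X.skel j ∧ σ ⊆ τ}.encard

/-- `Δ(X)`: the maximum of `Δ_{i,j}(X)` over all dimensions `i` and `j`. -/
noncomputable def maxDegree (X : AbstractSimplicialComplex V) : ℕ∞ :=
  ⨆ (i : ℕ) (j : ℕ), X.degree i j

end Combinatorics

section Homology

variable {V : Type*} [LinearOrder V]

/-- The boundary of a simplex `{v₀ < v₁ < ⋯ < v_k}`, oriented by the order of the vertices: it is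
`∑ i, (-1) ^ i • {v₀, …, v_k} \ {v_i}` for `1 ≤ k`, and `0` for a point. The index `i` of a vertex
`v` is the number of the vertices of the simplex that precede `v`. -/
noncomputable def simplexBoundary (s : Finset V) : Finset V →₀ ℤ :=
  if s.card ≤ 1 then 0
  else ∑ v ∈ s, Finsupp.single (s.erase v) ((-1) ^ (s.filter (· < v)).card)

/-- The simplicial boundary operator, on formal integral combinations of simplices. -/
noncomputable def boundary : (Finset V →₀ ℤ) →ₗ[ℤ] (Finset V →₀ ℤ) :=
  Finsupp.linearCombination ℤ simplexBoundary

/-- The group of simplicial `k`-chains of `X`: the integral combinations of the `k`-faces. -/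
def chains (X : AbstractSimplicialComplex V) (k : ℕ) : Submodule ℤ (Finset V →₀ ℤ) :=
  Finsupp.supported ℤ ℤ (X.skel k)

/-- The group of `k`-cycles. -/
noncomputable def cycles (X : AbstractSimplicialComplex V) (k : ℕ) :
    Submodule ℤ (Finset V →₀ ℤ) :=
  X.chains k ⊓ LinearMap.ker boundary

/-- The group of `k`-boundaries. -/
noncomputable def boundaries (X : AbstractSimplicialComplex V) (k : ℕ) :
    Submodule ℤ (Finset V →₀ ℤ) :=
  (X.chains (k + 1)).map boundary

theorem boundary_single (s : Finset V) :
    boundary (Finsupp.single s 1) = simplexBoundary s := by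
  simp [boundary]

theorem boundary_simplexBoundary (s : Finset V) : boundary (simplexBoundary s) = 0 := by
  by_cases h1 : s.card ≤ 1
  · simp [simplexBoundary, h1]
  by_cases h2 : s.card = 2
  · rw [simplexBoundary, if_neg h1, map_sum]
    refine Finset.sum_eq_zero fun v hv => ?_
    have : (s.erase v).card ≤ 1 := by rw [Finset.card_erase_of_mem hv]; omega
    simp [boundary, simplexBoundary, this]
  · rw [simplexBoundary, if_neg h1, map_sum]
    have key : ∀ v ∈ s, boundary (Finsupp.single (s.erase v)
        ((-1 : ℤ) ^ (s.filter (· < v)).card)) =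
        ∑ w ∈ s.erase v, Finsupp.single ((s.erase v).erase w)
          ((-1 : ℤ) ^ (s.filter (· < v)).card *
            (-1) ^ ((s.erase v).filter (· < w)).card) := by
      intro v hv
      have : ¬ (s.erase v).card ≤ 1 := by rw [Finset.card_erase_of_mem hv]; omega
      simp [boundary, simplexBoundary, this, Finset.smul_sum]
    rw [Finset.sum_congr rfl key, Finset.sum_sigma']
    have aux : ∀ v ∈ s, ∀ w ∈ s, v < w →
        (-1 : ℤ) ^ (s.filter (· < v)).card * (-1) ^ ((s.erase v).filter (· < w)).card +
        (-1 : ℤ) ^ (s.filter (· < w)).card * (-1) ^ ((s.erase w).filter (· < v)).card = 0 := by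
      intro v hv w hw hvw
      have e1 : (s.erase w).filter (· < v) = s.filter (· < v) := by
        ext x; simp only [Finset.mem_filter, Finset.mem_erase]
        constructor
        · rintro ⟨⟨_, h⟩, h'⟩; exact ⟨h, h'⟩
        · rintro ⟨h, h'⟩; exact ⟨⟨(h'.trans hvw).ne, h⟩, h'⟩
      have e2 : (s.erase v).filter (· < w) = (s.filter (· < w)).erase v := by
        ext x; simp only [Finset.mem_filter, Finset.mem_erase]; tauto
      have hm : v ∈ s.filter (· < w) := by simp [hv, hvw]
      have e3 : (s.filter (· < w)).card = ((s.erase v).filter (· < w)).card + 1 := by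
        rw [e2, Finset.card_erase_add_one hm]
      rw [e1, e3]; ring
    refine Finset.sum_involution (fun p _ => ⟨p.2, p.1⟩) ?_ ?_ ?_ ?_
    · rintro ⟨v, w⟩ hp
      simp only [Finset.mem_sigma, Finset.mem_erase] at hp
      obtain ⟨hv, hne, hw⟩ := hp
      simp only
      rw [Finset.erase_right_comm (a := w) (b := v), ← Finsupp.single_add]
      rcases lt_or_gt_of_ne hne with h | h
      · rw [add_comm, aux w hw v hv h, Finsupp.single_zero]
      · rw [aux v hv w hw h, Finsupp.single_zero]
    · rintro ⟨v, w⟩ hp _ heq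
      simp only [Finset.mem_sigma, Finset.mem_erase] at hp
      simp only [Sigma.mk.injEq, heq_eq_eq] at heq
      exact hp.2.1 heq.1
    · rintro ⟨v, w⟩ hp
      simp only [Finset.mem_sigma, Finset.mem_erase] at hp ⊢
      exact ⟨hp.2.2, hp.2.1.symm, hp.1⟩
    · rintro ⟨v, w⟩ _
      rfl

theorem boundary_boundary (c : Finset V →₀ ℤ) : boundary (boundary c) = 0 := by
  induction c using Finsupp.induction_linear with
  | zero => simp
  | add f g hf hg => simp [hf, hg]
  | single s a =>
    have : Finsupp.single s a = a • Finsupp.single s (1 : ℤ) := by simp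
    rw [this, map_smul, map_smul, boundary_single, boundary_simplexBoundary, smul_zero]

theorem boundaries_le_cycles (X : AbstractSimplicialComplex V) (k : ℕ) :
    X.boundaries k ≤ X.cycles k := by
  rintro _ ⟨c, hc, rfl⟩
  refine ⟨?_, boundary_boundary c⟩
  have hc' : c ∈ Finsupp.supported ℤ ℤ (X.skel (k + 1)) := hc
  rw [Finsupp.supported_eq_span_single] at hc'
  induction hc' using Submodule.span_induction with
  | zero => simp
  | add x y hx hy h1 h2 =>
    rw [← Finsupp.supported_eq_span_single] at hx hy
    rw [map_add]; exact add_mem (h1 hx) (h2 hy)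
  | smul a x hx h =>
    rw [← Finsupp.supported_eq_span_single] at hx
    rw [map_smul]; exact Submodule.smul_mem _ _ (h hx)
  | mem x hx =>
    obtain ⟨s, ⟨hs, hcard⟩, rfl⟩ := hx
    rw [boundary_single, simplexBoundary, if_neg (by omega)]
    refine sum_mem fun v hv => Finsupp.single_mem_supported ℤ _ ⟨?_, ?_⟩
    · refine (X.isRelLowerSet_faces hs).2 (Finset.erase_subset v s) ?_
      rw [← Finset.card_pos, Finset.card_erase_of_mem hv]; omega
    · rw [Finset.card_erase_of_mem hv]; omega

/-- The simplicial homology group `H_k(X; ℤ)`: cycles modulo boundaries. -/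
abbrev homology (X : AbstractSimplicialComplex V) (k : ℕ) : Type _ :=
  ↥(X.cycles k) ⧸ (X.boundaries k).submoduleOf (X.cycles k)

end Homology

end AbstractSimplicialComplex

/-! The torsion of `H_{d-1}` depends only on the lattice spanned by the boundaries of the `d`-faces,
so the task is to choose `d`-simplices whose boundaries satisfy prescribed relations.

Take a family `D` of `d`-simplices and some absent simplices `t j` such that the boundaries of all
of them together span a saturated subgroup with the `∂ t j` independent modulo `∂D`. Add to `D`
closing simplices `c j` with `∂ c j = ± m j • ∂ t j` modulo `∂D`. The torsion is then `∏ j, ℤ/m j`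
(`torsion_homology_equiv`). Saturation and independence come from collapsibility: if each simplex,
when added, has a facet lying in no earlier one, the boundary matrix is triangular with diagonal
entries `±1`.

Logarithmic size comes from repeated doubling. A gadget is a fixed triangulated piece that passes
from a pair `(u, g)` to a pair `(u', g')` with `∂u' = 2∂u + b∂g` and `∂g' = ∂g`. For general `d` it
is joined with the boundary of a `(d-2)`-simplex (`relation_mem_boundarySpan_block`), and translates
of it are stacked. Starting with `u` filled, that is with multiple `0`, one gadget per binary digit
of `m` reaches a simplex with boundary `± m • ∂g` (`Stage.run`). The factors of a finite abelian
group are treated one after another along the same line of levels (`exists_stage`).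

Every simplex used has diameter less than `7 * d` in the integer labelling, so all faces can be
confined to windows of bounded length, which bounds the degrees. -/

namespace AbstractSimplicialComplex

/-! ### Collapsible families and unimodularity of their boundaries -/

section Collapse

variable {V : Type*} [LinearOrder V]

/-- The subgroup spanned by the boundaries of the simplices in `D`. -/
noncomputable def boundarySpan (D : Finset (Finset V)) : Submodule ℤ (Finset V →₀ ℤ) :=
  Submodule.span ℤ (simplexBoundary '' (D : Set (Finset V)))

theorem boundarySpan_mono {D E : Finset (Finset V)} (h : D ⊆ E) :
    boundarySpan D ≤ boundarySpan E :=
  Submodule.span_mono (Set.image_mono (by exact_mod_cast h))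

theorem simplexBoundary_mem_boundarySpan {D : Finset (Finset V)} {s : Finset V} (h : s ∈ D) :
    simplexBoundary s ∈ boundarySpan D :=
  Submodule.subset_span ⟨s, h, rfl⟩

/-- A family of simplices that can be built up by adding one simplex at a time, each with a facet
that is not contained in any of the previous ones. -/
inductive Collapsible : Finset (Finset V) → Prop
  | nil : Collapsible ∅
  | cons (D : Finset (Finset V)) (s : Finset V) (v : V) : Collapsible D → v ∈ s →
      2 ≤ s.card → (∀ t ∈ D, ¬ s.erase v ⊆ t) → Collapsible (insert s D)

theorem simplexBoundary_eq_sum {s : Finset V} (hs : 2 ≤ s.card) :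
    simplexBoundary s =
      ∑ v ∈ s, Finsupp.single (s.erase v) ((-1) ^ (s.filter (· < v)).card) :=
  if_neg (by omega)

theorem simplexBoundary_apply_of_not_subset {s r : Finset V} (h : ¬ r ⊆ s) :
    simplexBoundary s r = 0 := by
  by_cases hs : s.card ≤ 1
  · simp [simplexBoundary, hs]
  · rw [simplexBoundary_eq_sum (by omega), Finsupp.finsetSum_apply]
    refine Finset.sum_eq_zero fun v _ => Finsupp.single_eq_of_ne ?_
    rintro rfl
    exact h (Finset.erase_subset _ _)

theorem simplexBoundary_apply_erase {s : Finset V} {v : V} (hv : v ∈ s) (hs : 2 ≤ s.card) :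
    simplexBoundary s (s.erase v) = (-1) ^ (s.filter (· < v)).card := by
  rw [simplexBoundary_eq_sum hs, Finsupp.finsetSum_apply, Finset.sum_eq_single v]
  · simp
  · intro w hw hne
    refine Finsupp.single_eq_of_ne fun h => ?_
    have : w ∈ s.erase v := Finset.mem_erase.2 ⟨hne, hw⟩
    rw [h] at this
    simp at this
  · exact fun h => absurd hv h

theorem apply_eq_zero_of_mem_boundarySpan {D : Finset (Finset V)} {r : Finset V}
    (h : ∀ t ∈ D, ¬ r ⊆ t) {x : Finset V →₀ ℤ} (hx : x ∈ boundarySpan D) : x r = 0 := by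
  induction hx using Submodule.span_induction with
  | mem x hx => obtain ⟨s, hs, rfl⟩ := hx; exact simplexBoundary_apply_of_not_subset (h s hs)
  | zero => rfl
  | add x y _ _ h1 h2 => simp [h1, h2]
  | smul a x _ h1 => simp [h1]

theorem boundarySpan_insert (s : Finset V) (D : Finset (Finset V)) :
    boundarySpan (insert s D) = Submodule.span ℤ {simplexBoundary s} ⊔ boundarySpan D := by
  rw [boundarySpan, Finset.coe_insert, Set.image_insert_eq, Submodule.span_insert]; rfl

theorem boundarySpan_union (D E : Finset (Finset V)) :
    boundarySpan (D ∪ E) = boundarySpan D ⊔ boundarySpan E := by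
  rw [boundarySpan, Finset.coe_union, Set.image_union, Submodule.span_union]; rfl

/-- The boundaries of a collapsible family span a saturated subgroup. -/
theorem Collapsible.saturated {D : Finset (Finset V)} (hD : Collapsible D) (n : ℤ) (hn : n ≠ 0)
    (x : Finset V →₀ ℤ) (hx : n • x ∈ boundarySpan D) : x ∈ boundarySpan D := by
  induction hD generalizing x with
  | nil =>
    simp only [boundarySpan, Finset.coe_empty, Set.image_empty, Submodule.span_empty,
      Submodule.mem_bot, smul_eq_zero, hn, false_or] at hx ⊢
    exact hx
  | cons D s v hD hv hs hfree ih =>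
    rw [boundarySpan_insert, Submodule.mem_sup] at hx
    obtain ⟨y, hy, b, hb, hxy⟩ := hx
    obtain ⟨k, rfl⟩ := Submodule.mem_span_singleton.1 hy
    -- The free facet occurs in no earlier boundary and with coefficient `±1` in that of `s`.
    -- Comparing coefficients there shows that `n` divides `k`, so a multiple of the last boundary
    -- can be subtracted.
    have hb0 := apply_eq_zero_of_mem_boundarySpan hfree hb
    obtain ⟨e, he, hee⟩ : ∃ e : ℤ, simplexBoundary s (s.erase v) = e ∧ e * e = 1 :=
      ⟨_, simplexBoundary_apply_erase hv hs, by rw [← mul_pow]; simp⟩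
    have hc : k * e = n * x (s.erase v) := by
      have := DFunLike.congr_fun hxy (s.erase v)
      simpa [he, hb0] using this
    have hk : k = n * (x (s.erase v) * e) := by linear_combination e * hc - k * hee
    have key : x - (x (s.erase v) * e) • simplexBoundary s ∈ boundarySpan D := by
      apply ih
      convert hb using 1
      rw [smul_sub, ← hxy, smul_smul, ← hk]
      abel
    have := add_mem (boundarySpan_mono (Finset.subset_insert s D) key)
      (Submodule.smul_mem _ (x (s.erase v) * e)
        (simplexBoundary_mem_boundarySpan (Finset.mem_insert_self s D)))
    simpa using this

/-- The boundaries of a collapsible family can be prescribed arbitrary values by a functional. -/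
theorem Collapsible.exists_functional {D : Finset (Finset V)} (hD : Collapsible D)
    (c : Finset V → ℤ) :
    ∃ ψ : (Finset V →₀ ℤ) →ₗ[ℤ] ℤ, ∀ s ∈ D, ψ (simplexBoundary s) = c s := by
  induction hD with
  | nil => exact ⟨0, by simp⟩
  | cons D s v hD hv hs hfree ih =>
    obtain ⟨ψ, hψ⟩ := ih
    obtain ⟨e, he, hee⟩ : ∃ e : ℤ, simplexBoundary s (s.erase v) = e ∧ e * e = 1 :=
      ⟨_, simplexBoundary_apply_erase hv hs, by rw [← mul_pow]; simp⟩
    -- The correction reads only the coefficient of the free facet, so the values on earlier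
    -- boundaries do not change.
    refine ⟨ψ + ((c s - ψ (simplexBoundary s)) * e) • Finsupp.lapply (s.erase v), fun t ht => ?_⟩
    rcases Finset.mem_insert.1 ht with rfl | ht
    · simp only [LinearMap.add_apply, LinearMap.smul_apply, Finsupp.lapply_apply, he, smul_eq_mul]
      linear_combination (c t - ψ (simplexBoundary t)) * hee
    · simp [simplexBoundary_apply_of_not_subset (hfree t ht), hψ t ht]

/-- Adding the simplices in order of increasing `rank` works, since `hrank` lets a free facet
reappear only in simplices of larger rank. Taking `i ≠ j` with equal rank shows that ties may be
broken arbitrarily. -/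
theorem Collapsible.union_image {ι : Type*} {D : Finset (Finset V)} (hD : Collapsible D)
    (I : Finset ι) (f : ι → Finset V) (v : ι → V) (rank : ι → ℕ)
    (hv : ∀ i ∈ I, v i ∈ f i) (hcard : ∀ i ∈ I, 2 ≤ (f i).card)
    (hD' : ∀ i ∈ I, ∀ t ∈ D, ¬ (f i).erase (v i) ⊆ t)
    (hrank : ∀ i ∈ I, ∀ j ∈ I, (f i).erase (v i) ⊆ f j → i ≠ j → rank i < rank j) :
    Collapsible (D ∪ I.image f) := by
  classical
  induction I using Finset.induction_on_max_value rank with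
  | empty => simpa using hD
  | insert a I ha hmax ih =>
    have hI : ∀ i ∈ I, i ∈ insert a I := fun i hi => Finset.mem_insert_of_mem hi
    have haI := Finset.mem_insert_self a I
    rw [Finset.image_insert, Finset.union_insert]
    refine Collapsible.cons _ _ (v a) (ih ?_ ?_ ?_ ?_) (hv a haI) (hcard a haI) ?_
    · exact fun i hi => hv i (hI i hi)
    · exact fun i hi => hcard i (hI i hi)
    · exact fun i hi => hD' i (hI i hi)
    · exact fun i hi j hj => hrank i (hI i hi) j (hI j hj)
    · intro t ht hsub
      rcases Finset.mem_union.1 ht with ht | ht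
      · exact hD' a haI t ht hsub
      · obtain ⟨j, hj, rfl⟩ := Finset.mem_image.1 ht
        have := hrank a haI j (hI j hj) hsub (by rintro rfl; exact ha hj)
        exact absurd (hmax j hj) (by omega)

end Collapse

/-! ### Torsion from a unimodular family with scaled relations -/

section Torsion

variable {V : Type*} [LinearOrder V]

/-- If the boundaries of `D` and of the simplices `T j` are part of a basis, then adding to the
cycle group modulo `∂ D` the relations `m j • ∂ (T j) = 0` yields the torsion `∏ j, ℤ / m j`. -/
theorem torsion_homology_equiv {ι : Type*} [Fintype ι] [DecidableEq ι]
    (X : AbstractSimplicialComplex V) (k : ℕ)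
    (D : Finset (Finset V)) (T : ι → Finset V) (m : ι → ℕ) (hm : ∀ j, m j ≠ 0)
    (ψ : ι → (Finset V →₀ ℤ) →ₗ[ℤ] ℤ)
    (hψD : ∀ j, ∀ s ∈ D, ψ j (simplexBoundary s) = 0)
    (hψT : ∀ i j, ψ i (simplexBoundary (T j)) = if i = j then 1 else 0)
    (hsat : ∀ n : ℤ, n ≠ 0 → ∀ x : Finset V →₀ ℤ,
      n • x ∈ boundarySpan D ⊔ Submodule.span ℤ (Set.range fun j => simplexBoundary (T j)) →
      x ∈ boundarySpan D ⊔ Submodule.span ℤ (Set.range fun j => simplexBoundary (T j)))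
    (hT : ∀ j, simplexBoundary (T j) ∈ X.cycles k)
    (hB : X.boundaries k =
      boundarySpan D ⊔ Submodule.span ℤ (Set.range fun j => (m j : ℤ) • simplexBoundary (T j))) :
    Nonempty (AddCommGroup.torsion (X.homology k) ≃+ ∀ j, ZMod (m j)) := by
  have hψD' : ∀ j, ∀ x ∈ boundarySpan D, ψ j x = 0 := by
    intro j x hx
    have : boundarySpan D ≤ LinearMap.ker (ψ j) := by
      rw [boundarySpan, Submodule.span_le]
      rintro _ ⟨s, hs, rfl⟩
      exact hψD j s hs
    exact this hx
  -- membership in the big span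
  have hbig : ∀ x, x ∈ boundarySpan D ⊔
      Submodule.span ℤ (Set.range fun j => simplexBoundary (T j)) →
      -- The `ψ j` are the coordinates along `∂ (T j)` modulo `∂ D`.
      ∃ b ∈ boundarySpan D, x = b + ∑ j, ψ j x • simplexBoundary (T j) := by
    intro x hx
    obtain ⟨b, hb, y, hy, rfl⟩ := Submodule.mem_sup.1 hx
    obtain ⟨c, rfl⟩ := (Submodule.mem_span_range_iff_exists_fun ℤ).1 hy
    refine ⟨b, hb, ?_⟩
    congr 1
    refine Finset.sum_congr rfl fun j _ => ?_
    simp [hψD' j b hb, hψT]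
  have hmem : ∀ x ∈ boundarySpan D ⊔
      Submodule.span ℤ (Set.range fun j => simplexBoundary (T j)),
      (∀ j, (m j : ℤ) ∣ ψ j x) → x ∈ X.boundaries k := by
    intro x hx hdvd
    obtain ⟨b, hb, hx'⟩ := hbig x hx
    rw [hx', hB]
    refine Submodule.add_mem_sup hb (sum_mem fun j _ => ?_)
    obtain ⟨c, hc⟩ := hdvd j
    rw [hc, mul_comm, ← smul_smul]
    exact Submodule.smul_mem _ _ (Submodule.subset_span ⟨j, rfl⟩)
  have hle : X.boundaries k ≤ boundarySpan D ⊔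
      Submodule.span ℤ (Set.range fun j => simplexBoundary (T j)) := by
    rw [hB]
    refine sup_le_sup_left ?_ _
    rw [Submodule.span_le]
    rintro _ ⟨j, rfl⟩
    exact Submodule.smul_mem _ _ (Submodule.subset_span ⟨j, rfl⟩)
  have hdvd : ∀ x ∈ X.boundaries k, ∀ j, (m j : ℤ) ∣ ψ j x := by
    intro x hx j
    rw [hB] at hx
    obtain ⟨b, hb, y, hy, rfl⟩ := Submodule.mem_sup.1 hx
    obtain ⟨c, rfl⟩ := (Submodule.mem_span_range_iff_exists_fun ℤ).1 hy
    simp [hψD' j b hb, hψT]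
  -- The isomorphism reduces the coordinates modulo `m j`. By saturation a torsion class lies in the
  -- big span, where divisibility of all coordinates means being a boundary.
  let Φ : (Finset V →₀ ℤ) →ₗ[ℤ] ∀ j, ZMod (m j) :=
    LinearMap.pi fun j => (Algebra.linearMap ℤ (ZMod (m j))).comp (ψ j)
  have hΦ : ∀ x j, Φ x j = ((ψ j x : ℤ) : ZMod (m j)) := fun x j => by simp [Φ]
  let Ψ : X.homology k →ₗ[ℤ] ∀ j, ZMod (m j) :=
    Submodule.liftQ _ (Φ.comp (X.cycles k).subtype) (by
      intro x hx
      have hx' : (x : Finset V →₀ ℤ) ∈ X.boundaries k := hx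
      rw [LinearMap.mem_ker]
      funext j
      rw [LinearMap.comp_apply, Submodule.subtype_apply, hΦ]
      exact (ZMod.intCast_zmod_eq_zero_iff_dvd _ _).2 (hdvd _ hx' j))
  have hΨ : ∀ z : X.cycles k, ∀ j,
      Ψ (Submodule.Quotient.mk z) j = ((ψ j z : ℤ) : ZMod (m j)) := fun z j => hΦ z j
  refine ⟨AddEquiv.ofBijective
    (Ψ.toAddMonoidHom.comp (AddCommGroup.torsion (X.homology k)).subtype) ⟨?_, ?_⟩⟩
  · rw [injective_iff_map_eq_zero]
    rintro ⟨q, hq⟩ h0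
    obtain ⟨z, rfl⟩ := Submodule.Quotient.mk_surjective _ q
    obtain ⟨n, hn, hn0⟩ := isOfFinAddOrder_iff_nsmul_eq_zero.1 hq
    have hnz : n • (z : Finset V →₀ ℤ) ∈ X.boundaries k := by
      rw [← Submodule.Quotient.mk_smul, Submodule.Quotient.mk_eq_zero] at hn0
      exact hn0
    have hz := hsat n (by exact_mod_cast hn.ne') z (hle (by simpa using hnz))
    have : (z : Finset V →₀ ℤ) ∈ X.boundaries k := hmem z hz fun j => by
      have := congrFun h0 j
      exact (ZMod.intCast_zmod_eq_zero_iff_dvd _ _).1 ((hΨ z j).symm.trans this)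
    exact Subtype.ext ((Submodule.Quotient.mk_eq_zero _).2 this)
  · intro y
    let z : X.cycles k := ∑ j, ((y j).val : ℤ) • ⟨simplexBoundary (T j), hT j⟩
    have hz : (z : Finset V →₀ ℤ) = ∑ j, ((y j).val : ℤ) • simplexBoundary (T j) := by
      simp [z]
    have hψz : ∀ j, ψ j z = (y j).val := fun j => by simp [hz, hψT]
    refine ⟨⟨Submodule.Quotient.mk z, ?_⟩, ?_⟩
    · refine isOfFinAddOrder_iff_nsmul_eq_zero.2
        ⟨∏ j, m j, Nat.pos_of_ne_zero (Finset.prod_ne_zero_iff.2 fun j _ => hm j), ?_⟩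
      rw [← Submodule.Quotient.mk_smul, Submodule.Quotient.mk_eq_zero]
      refine hmem _ ?_ fun j => ?_
      · refine Submodule.mem_sup_right ?_
        rw [map_nsmul, Submodule.subtype_apply, hz]
        exact Submodule.smul_of_tower_mem _ _ (sum_mem fun j _ =>
          Submodule.smul_mem _ _ (Submodule.subset_span ⟨j, rfl⟩))
      · rw [map_nsmul, map_nsmul, nsmul_eq_mul]
        exact Dvd.dvd.mul_right (by exact_mod_cast Finset.dvd_prod_of_mem m (Finset.mem_univ j)) _
    · funext j
      have : NeZero (m j) := ⟨hm j⟩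
      refine (hΨ z j).trans ?_
      rw [hψz]
      simp

end Torsion

/-! ### The explicit doubling and doubling-plus-one surfaces -/

section Gadgets

/-- A combinatorial surface on the vertices `0, …, 5` and `7, …, 12` (triangles `A k`, with a vertex
`r k` opposite to a facet along which the triangle can be collapsed) which contains the four
triangles `012`, `345`, `789` and `10 11 12`, and which exhibits the relations
`∂(789) = 2 ∂(012) + b ∂(345)` and `∂(10 11 12) = ∂(345)` modulo the other triangles. -/
structure Gadget (b : ℕ) where
  n : ℕ
  A : Fin n → Finset ℕ
  r : Fin n → ℕ
  u : Fin n
  g : Fin n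
  u' : Fin n
  g' : Fin n
  c₁ : Fin n → ℤ
  c₂ : Fin n → ℤ
  A_u : A u = {0, 1, 2}
  A_g : A g = {3, 4, 5}
  A_u' : A u' = {7, 8, 9}
  A_g' : A g' = {10, 11, 12}
  card_A : ∀ k, (A k).card = 3
  lt_of_mem : ∀ k, ∀ x ∈ A k, x < 13 ∧ x % 7 ≠ 6
  r_mem : ∀ k, r k ∈ A k
  -- The numbering is a collapsing order. In a block, simplices over `u'` and `g'` lose the apex
  -- vertex `13` instead, so for these two it suffices that no other triangle equals them (`top`).
  -- The condition `new` keeps free facets out of lower levels.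
  free : ∀ k l, k ≠ u' → k ≠ g' → (A k).erase (r k) ⊆ A l → k ≤ l
  top : ∀ k l, k = u' ∨ k = g' → A k ⊆ A l → l = k
  new : ∀ k, k ≠ u → k ≠ g → ∃ x ∈ (A k).erase (r k), 7 ≤ x
  ne : u ≠ g ∧ u ≠ u' ∧ u ≠ g' ∧ g ≠ u' ∧ g ≠ g' ∧ u' ≠ g'
  c₁_eq : c₁ u = -2 ∧ c₁ g = -b ∧ c₁ u' = 1 ∧ c₁ g' = 0
  c₂_eq : c₂ u = 0 ∧ c₂ g = -1 ∧ c₂ u' = 0 ∧ c₂ g' = 1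
  rel₁ : ∑ k, c₁ k • simplexBoundary (A k) = 0
  rel₂ : ∑ k, c₂ k • simplexBoundary (A k) = 0

theorem simplexBoundary_triple {V : Type*} [LinearOrder V] {x y z : V} (hxy : x < y) (hyz : y < z) :
    simplexBoundary ({x, y, z} : Finset V) =
      Finsupp.single {y, z} 1 - Finsupp.single {x, z} 1 + Finsupp.single {x, y} 1 := by
  have hxz := hxy.trans hyz
  have hcard : ({x, y, z} : Finset V).card = 3 :=
    Finset.card_eq_three.2 ⟨x, y, z, hxy.ne, hxz.ne, hyz.ne, rfl⟩
  rw [simplexBoundary_eq_sum (by omega), Finset.sum_insert (by simp [hxy.ne, hxz.ne]),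
    Finset.sum_insert (by simp [hyz.ne]), Finset.sum_singleton]
  have e1 : ({x, y, z} : Finset V).erase x = {y, z} := by grind
  have e2 : ({x, y, z} : Finset V).erase y = {x, z} := by grind
  have e3 : ({x, y, z} : Finset V).erase z = {x, y} := by grind
  have f1 : ({x, y, z} : Finset V).filter (· < x) = ∅ := by grind
  have f2 : ({x, y, z} : Finset V).filter (· < y) = {x} := by grind
  have f3 : ({x, y, z} : Finset V).filter (· < z) = {x, y} := by grind
  rw [e1, e2, e3, f1, f2, f3, Finset.card_pair hxy.ne]
  simp [Finsupp.single_neg]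
  abel

/-- The gadget for doubling. -/
def doublingGadget : Gadget 0 where
  n := 19
  -- The vertices 7, 8, 9 are coned over the paths 0-1-2, 2-0-1, 1-2-0, which together run twice
  -- around `012`. Three more triangles complete an annulus ending in the loop 7-8-9. A plain
  -- annulus joins `345` to `10 11 12`.
  A :=
    ![{0, 1, 2}, {3, 4, 5}, {0, 1, 7}, {1, 2, 7}, {0, 2, 8}, {0, 1, 8}, {1, 2, 9}, {0, 2, 9},
    {3, 4, 10}, {4, 5, 11}, {3, 5, 12}, {2, 7, 8}, {1, 8, 9}, {0, 7, 9}, {4, 10, 11}, {5, 11, 12},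
    {3, 10, 12}, {7, 8, 9}, {10, 11, 12}]
  r :=
    ![0, 3, 0, 1, 2, 0, 1, 2, 3, 4, 5, 2, 1, 0, 4, 5, 3, 7, 10]
  u := 0
  g := 1
  u' := 17
  g' := 18
  c₁ :=
    ![-2, 0, 1, 1, -1, 1, 1, -1, 0, 0, 0, -1, -1, 1, 0, 0, 0, 1, 0]
  c₂ :=
    ![0, -1, 0, 0, 0, 0, 0, 0, 1, 1, -1, 0, 0, 0, -1, -1, 1, 0, 1]
  A_u := rfl
  A_g := rfl
  A_u' := rfl
  A_g' := rfl
  card_A := by decide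
  lt_of_mem := by decide
  r_mem := by decide
  free := by decide +kernel
  top := by decide +kernel
  new := by decide +kernel
  ne := by decide
  c₁_eq := by decide
  c₂_eq := by decide
  rel₁ := by
    simp only [Fin.sum_univ_succ, Fin.sum_univ_zero]
    simp [simplexBoundary_triple, -Finsupp.smul_single]
    abel
  rel₂ := by
    simp only [Fin.sum_univ_succ, Fin.sum_univ_zero]
    simp [simplexBoundary_triple, -Finsupp.smul_single]
    abel

/-- The gadget for doubling and adding. -/
def doublingAddGadget : Gadget 1 where
  n := 24
  -- The paths below 7, 8, 9 are now 5-3-0-1-2, 2-0-1 and 1-2-0-3-4-5: twice around `012`, then once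
  -- around `345`, with the edge `03` used in both directions.
  A :=
    ![{0, 1, 2}, {3, 4, 5}, {3, 5, 7}, {0, 3, 7}, {0, 1, 7}, {1, 2, 7}, {0, 2, 8}, {0, 1, 8}, {1,
    2, 9}, {0, 2, 9}, {0, 3, 9}, {3, 4, 9}, {4, 5, 9}, {3, 4, 10}, {4, 5, 11}, {3, 5, 12}, {2, 7,
    8}, {1, 8, 9}, {5, 7, 9}, {4, 10, 11}, {5, 11, 12}, {3, 10, 12}, {7, 8, 9}, {10, 11, 12}]
  r :=
    ![0, 3, 5, 3, 0, 1, 2, 0, 1, 2, 0, 3, 4, 3, 4, 5, 2, 1, 5, 4, 5, 3, 7, 10]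
  u := 0
  g := 1
  u' := 22
  g' := 23
  c₁ :=
    ![-2, -1, -1, -1, 1, 1, -1, 1, 1, -1, 1, 1, 1, 0, 0, 0, -1, -1, 1, 0, 0, 0, 1, 0]
  c₂ :=
    ![0, -1, 0, 0, 0, 0, 0, 0, 0, 0, 0, 0, 0, 1, 1, -1, 0, 0, 0, -1, -1, 1, 0, 1]
  A_u := rfl
  A_g := rfl
  A_u' := rfl
  A_g' := rfl
  card_A := by decide
  lt_of_mem := by decide
  r_mem := by decide
  free := by decide +kernel
  top := by decide +kernel
  new := by decide +kernel
  ne := by decide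
  c₁_eq := by decide
  c₂_eq := by decide
  rel₁ := by
    simp only [Fin.sum_univ_succ, Fin.sum_univ_zero]
    simp [simplexBoundary_triple, -Finsupp.smul_single]
    abel
  rel₂ := by
    simp only [Fin.sum_univ_succ, Fin.sum_univ_zero]
    simp [simplexBoundary_triple, -Finsupp.smul_single]
    abel

end Gadgets

/-! ### Chain maps of order embeddings -/

section Maps

variable {V W : Type*} [LinearOrder V] [LinearOrder W]

/-- The chain map induced by an order embedding of the vertices. -/
noncomputable def chainMap (f : V ↪o W) : (Finset V →₀ ℤ) →ₗ[ℤ] (Finset W →₀ ℤ) :=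
  Finsupp.lmapDomain ℤ ℤ (Finset.map f.toEmbedding)

theorem chainMap_injective (f : V ↪o W) : Function.Injective (chainMap f) :=
  Finsupp.mapDomain_injective (Finset.map_injective _)

theorem chainMap_simplexBoundary (f : V ↪o W) (s : Finset V) :
    chainMap f (simplexBoundary s) = simplexBoundary (s.map f.toEmbedding) := by
  by_cases hs : s.card ≤ 1
  · simp [simplexBoundary, hs]
  rw [simplexBoundary_eq_sum (by omega), simplexBoundary_eq_sum (by rw [Finset.card_map]; omega),
    map_sum, Finset.sum_map]
  refine Finset.sum_congr rfl fun v _ => ?_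
  rw [chainMap, Finsupp.lmapDomain_apply, Finsupp.mapDomain_single, Finset.map_erase,
    Finset.filter_map, Finset.card_map]
  congr 4
  ext x
  simp

theorem map_chainMap_boundarySpan (f : V ↪o W) (D : Finset (Finset V)) :
    (boundarySpan D).map (chainMap f) = boundarySpan (D.image (Finset.map f.toEmbedding)) := by
  rw [boundarySpan, boundarySpan, Submodule.map_span, Finset.coe_image, Set.image_image,
    Set.image_image]
  simp only [chainMap_simplexBoundary]

end Maps

/-! ### Joining a relation with the boundary of a simplex -/

section Join

variable {V : Type*} [LinearOrder V]

/-- The Leibniz rule `∂(s * P) = ∂s * P ± s * ∂P`. Having `P` after `s` fixes the signs, and `2 ≤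
s.card` is needed because the boundary of a point is `0` here, not the empty simplex. -/
theorem simplexBoundary_union {s P : Finset V} (hs : 2 ≤ s.card) (h : ∀ a ∈ s, ∀ p ∈ P, a < p) :
    simplexBoundary (s ∪ P) = Finsupp.lmapDomain ℤ ℤ (· ∪ P) (simplexBoundary s) +
      ∑ x ∈ P, ((-1) ^ s.card * (-1) ^ (P.filter (· < x)).card) •
        Finsupp.single (s ∪ P.erase x) (1 : ℤ) := by
  have hdisj : Disjoint s P := Finset.disjoint_left.2 fun a ha hp => (h a ha a hp).false
  have hcard : 2 ≤ (s ∪ P).card := hs.trans (Finset.card_le_card Finset.subset_union_left)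
  rw [simplexBoundary_eq_sum hs, simplexBoundary_eq_sum hcard, Finset.sum_union hdisj, map_sum]
  congr 1
  · refine Finset.sum_congr rfl fun v hv => ?_
    rw [Finsupp.lmapDomain_apply, Finsupp.mapDomain_single, Finset.erase_union_distrib,
      Finset.erase_eq_of_notMem (Finset.disjoint_left.1 hdisj hv), Finset.filter_union]
    have : P.filter (· < v) = ∅ := Finset.filter_eq_empty_iff.2 fun p hp => (h v hv p hp).not_gt
    rw [this, Finset.union_empty]
  · refine Finset.sum_congr rfl fun x hx => ?_
    rw [Finset.erase_union_distrib, Finset.erase_eq_of_notMem (Finset.disjoint_right.1 hdisj hx),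
      Finset.filter_union, Finset.card_union_of_disjoint (Finset.disjoint_filter_filter hdisj),
      Finset.filter_true_of_mem fun a ha => h a ha x hx, pow_add]
    simp

/-- A relation between the boundaries of some simplices, joined with the boundary of a simplex. -/
theorem sum_simplexBoundary_union_erase {ι : Type*} [Fintype ι] (A : ι → Finset V)
    (c : ι → ℤ) (P : Finset V) {n : ℕ} (hn : 2 ≤ n) (hcard : ∀ k, (A k).card = n)
    (hlt : ∀ k, ∀ a ∈ A k, ∀ p ∈ P, a < p) (hc : ∑ k, c k • simplexBoundary (A k) = 0) :
    ∑ k, ∑ x ∈ P, (c k * (-1) ^ (P.filter (· < x)).card) • simplexBoundary (A k ∪ P.erase x) =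
      0 := by
  -- Apply `∂` to the Leibniz rule for `∑ c k • (A k * P)`: the left side dies by `∂∂ = 0` and the
  -- term `∂A * P` by `hc`, leaving `∂(∑ c k • (A k * ∂P)) = 0`.
  have h0 : ∑ k, c k • boundary (simplexBoundary (A k ∪ P)) = 0 :=
    Finset.sum_eq_zero fun k _ => by rw [boundary_simplexBoundary, smul_zero]
  have h1 : ∑ k, c k • boundary (Finsupp.lmapDomain ℤ ℤ (· ∪ P) (simplexBoundary (A k))) = 0 := by
    simp only [← map_smul, ← map_sum, hc, map_zero]
  have h2 : ∑ k, c k • boundary (∑ x ∈ P, ((-1) ^ (A k).card * (-1) ^ (P.filter (· < x)).card) •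
      Finsupp.single (A k ∪ P.erase x) (1 : ℤ)) = 0 := by
    rw [← h0, ← sub_eq_zero, ← neg_eq_zero, neg_sub, ← Finset.sum_sub_distrib, ← h1]
    refine Finset.sum_congr rfl fun k _ => ?_
    rw [simplexBoundary_union (by rw [hcard]; exact hn) (hlt k), map_add, smul_add,
      add_sub_cancel_right]
  have h3 : (-1 : ℤ) ^ n • ∑ k, ∑ x ∈ P,
      (c k * (-1) ^ (P.filter (· < x)).card) • simplexBoundary (A k ∪ P.erase x) = 0 := by
    rw [← h2, Finset.smul_sum]
    refine Finset.sum_congr rfl fun k _ => ?_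
    rw [map_sum, Finset.smul_sum, Finset.smul_sum]
    refine Finset.sum_congr rfl fun x _ => ?_
    rw [map_smul, boundary_single, smul_smul, smul_smul, hcard]
    congr 1
    ring
  rcases neg_one_pow_eq_or ℤ n with h | h <;> simpa [h] using h3

end Join

/-! ### Blocks: translated gadgets joined with a simplex boundary -/

section Blocks

/-- Translation of the vertices by `i` levels. -/
def shift (i : ℕ) : ℕ ↪o ℕ := OrderEmbedding.ofStrictMono (· + 7 * i) fun _ _ h => by simpa using h

@[simp] theorem shift_apply (i x : ℕ) : shift i x = x + 7 * i := rfl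

theorem map_shift_shift (s : Finset ℕ) (i j : ℕ) :
    (s.map (shift i).toEmbedding).map (shift j).toEmbedding = s.map (shift (i + j)).toEmbedding := by
  rw [Finset.map_map]
  congr 1
  ext x
  simp
  ring

/-- The simplex with whose boundary a gadget is joined. -/
def apexSet (d : ℕ) : Finset ℕ := (Finset.range (d - 1)).image fun j => 7 * j + 13

/-- The facet of `apexSet d` opposite to its last vertex. -/
def apexFacet (d : ℕ) : Finset ℕ := (Finset.range (d - 2)).image fun j => 7 * j + 13

theorem mem_apexSet {d x : ℕ} (hd : 2 ≤ d) :
    x ∈ apexSet d ↔ x % 7 = 6 ∧ 13 ≤ x ∧ x < 7 * d := by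
  simp only [apexSet, Finset.mem_image, Finset.mem_range]
  constructor
  · rintro ⟨j, hj, rfl⟩; omega
  · rintro ⟨h1, h2, h3⟩; exact ⟨(x - 13) / 7, by omega, by omega⟩

theorem mem_apexFacet {d x : ℕ} (hd : 2 ≤ d) :
    x ∈ apexFacet d ↔ x % 7 = 6 ∧ 13 ≤ x ∧ x + 1 < 7 * d := by
  simp only [apexFacet, Finset.mem_image, Finset.mem_range]
  constructor
  · rintro ⟨j, hj, rfl⟩; omega
  · rintro ⟨h1, h2, h3⟩; exact ⟨(x - 13) / 7, by omega, by omega⟩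

theorem card_apexSet (d : ℕ) : (apexSet d).card = d - 1 := by
  rw [apexSet, Finset.card_image_of_injective _ fun a b h => by simpa using h, Finset.card_range]

theorem card_apexFacet (d : ℕ) : (apexFacet d).card = d - 2 := by
  rw [apexFacet, Finset.card_image_of_injective _ fun a b h => by simpa using h, Finset.card_range]

theorem apexSet_erase_last {d : ℕ} (hd : 2 ≤ d) : (apexSet d).erase (7 * d - 1) = apexFacet d := by
  ext x
  rw [Finset.mem_erase, mem_apexSet hd, mem_apexFacet hd]
  omega

theorem apexSet_erase_first {d : ℕ} (hd : 2 ≤ d) :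
    (apexSet d).erase 13 = (apexFacet d).map (shift 1).toEmbedding := by
  ext x
  simp only [Finset.mem_erase, mem_apexSet hd, Finset.mem_map, mem_apexFacet hd,
    RelEmbedding.coe_toEmbedding, shift_apply]
  constructor
  · rintro ⟨h1, h2, h3, h4⟩; exact ⟨x - 7, by omega, by omega⟩
  · rintro ⟨y, h1, rfl⟩; omega

/-- The missing `d`-simplex at level `i` that carries the current multiple. -/
def uSimplex (d i : ℕ) : Finset ℕ := (({0, 1, 2} : Finset ℕ) ∪ apexFacet d).map (shift i).toEmbedding

/-- The missing `d`-simplex at level `i` that carries the generator. -/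
def gSimplex (d i : ℕ) : Finset ℕ := (({3, 4, 5} : Finset ℕ) ∪ apexFacet d).map (shift i).toEmbedding

/-- The simplex uses only vertices that are available at level `i`. -/
def Low (d i : ℕ) (s : Finset ℕ) : Prop :=
  ∀ x ∈ s, (x < 7 * i + 7 ∨ x % 7 = 6) ∧ x + 1 < 7 * (i + d)

theorem Low.mono {d i j : ℕ} (h : i ≤ j) {s : Finset ℕ} (hs : Low d i s) : Low d j s := by
  intro x hx
  have h1 := hs x hx
  have h2 : 7 * (i + d) ≤ 7 * (j + d) := by omega
  omega

/-- A `d`-simplex whose vertices are at bounded distance. -/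
def Narrow (d : ℕ) (s : Finset ℕ) : Prop :=
  s.card = d + 1 ∧ ∀ x ∈ s, ∀ y ∈ s, x < y + 7 * d

variable {b : ℕ} (q : Gadget b) (d : ℕ)

/-- The indices of the simplices that make up a block. -/
def blockIndex : Finset (Fin q.n × ℕ) :=
  (Finset.univ ×ˢ apexSet d).filter fun p =>
    ((p.1 = q.u ∨ p.1 = q.g) → p.2 ≠ 7 * d - 1) ∧ ((p.1 = q.u' ∨ p.1 = q.g') → p.2 ≠ 13)

/-- The simplices that make up a block. -/
def blockFace (i : ℕ) (p : Fin q.n × ℕ) : Finset ℕ :=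
  (q.A p.1 ∪ (apexSet d).erase p.2).map (shift i).toEmbedding

/-- The `i`-th block: the join of a gadget with the boundary of a simplex, without the simplices
that are to be left open. -/
def block (i : ℕ) : Finset (Finset ℕ) := (blockIndex q d).image (blockFace q d i)

variable {q d}

theorem mem_blockIndex {p : Fin q.n × ℕ} : p ∈ blockIndex q d ↔ p.2 ∈ apexSet d ∧
    ((p.1 = q.u ∨ p.1 = q.g) → p.2 ≠ 7 * d - 1) ∧ ((p.1 = q.u' ∨ p.1 = q.g') → p.2 ≠ 13) := by
  simp [blockIndex]

theorem card_blockFace (hd : 2 ≤ d) (i : ℕ) {p : Fin q.n × ℕ} (hp : p.2 ∈ apexSet d) :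
    (blockFace q d i p).card = d + 1 := by
  rw [blockFace, Finset.card_map, Finset.card_union_of_disjoint, q.card_A,
    Finset.card_erase_of_mem hp, card_apexSet]
  · omega
  · refine Finset.disjoint_left.2 fun x hx hx' => ?_
    have := (q.lt_of_mem _ x hx).1
    have := (mem_apexSet hd).1 (Finset.mem_of_mem_erase hx')
    omega

theorem exists_of_mem_blockFace (hd : 2 ≤ d) {i : ℕ} {p : Fin q.n × ℕ} {x : ℕ}
    (hx : x ∈ blockFace q d i p) :
    ∃ y, x = y + 7 * i ∧ (y < 13 ∧ y % 7 ≠ 6 ∨ y % 7 = 6 ∧ 13 ≤ y ∧ y < 7 * d) := by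
  obtain ⟨y, hy, rfl⟩ := Finset.mem_map.1 hx
  refine ⟨y, rfl, ?_⟩
  rcases Finset.mem_union.1 hy with hy | hy
  · exact Or.inl (q.lt_of_mem _ y hy)
  · exact Or.inr ((mem_apexSet hd).1 (Finset.mem_of_mem_erase hy))

theorem low_of_mem_block (hd : 2 ≤ d) {i : ℕ} {s : Finset ℕ} (hs : s ∈ block q d i) :
    Low d (i + 1) s := by
  obtain ⟨p, -, rfl⟩ := Finset.mem_image.1 hs
  intro x hx
  obtain ⟨y, rfl, hy⟩ := exists_of_mem_blockFace hd hx
  omega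

theorem narrow_of_mem_block (hd : 2 ≤ d) {i : ℕ} {s : Finset ℕ} (hs : s ∈ block q d i) :
    Narrow d s := by
  obtain ⟨p, hp, rfl⟩ := Finset.mem_image.1 hs
  refine ⟨card_blockFace hd i (mem_blockIndex.1 hp).1, fun x hx y hy => ?_⟩
  obtain ⟨x, rfl, hx⟩ := exists_of_mem_blockFace hd hx
  obtain ⟨y, rfl, hy⟩ := exists_of_mem_blockFace hd hy
  omega

/-- The vertex opposite to the facet along which a simplex of a block can be collapsed. -/
def blockVertex (q : Gadget b) (p : Fin q.n × ℕ) : ℕ :=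
  if p.1 = q.u' ∨ p.1 = q.g' then 13 else q.r p.1

theorem blockFace_erase (i : ℕ) (p : Fin q.n × ℕ) :
    (blockFace q d i p).erase (blockVertex q p + 7 * i) =
      ((q.A p.1 ∪ (apexSet d).erase p.2).erase (blockVertex q p)).map (shift i).toEmbedding := by
  rw [Finset.map_erase]; rfl

/-- The free facet contains a vertex not available at level `i`: over `u` and `g` it is the last
apex vertex `7 * d - 1`, which survives because the faces lacking it are left out of the block;
elsewhere it is the upper vertex given by `new`. -/
theorem not_blockFace_erase_subset (hd : 2 ≤ d) {i : ℕ} {p : Fin q.n × ℕ}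
    (hp : p ∈ blockIndex q d) {t : Finset ℕ} (ht : Low d i t) :
    ¬ (blockFace q d i p).erase (blockVertex q p + 7 * i) ⊆ t := by
  rw [blockFace_erase]
  intro h
  obtain ⟨hpP, hp1, hp2⟩ := mem_blockIndex.1 hp
  have key : ∀ y ∈ (q.A p.1 ∪ (apexSet d).erase p.2).erase (blockVertex q p),
      (y + 7 * i < 7 * i + 7 ∨ (y + 7 * i) % 7 = 6) ∧ y + 7 * i + 1 < 7 * (i + d) :=
    fun y hy => ht _ (h (Finset.mem_map_of_mem _ hy))
  by_cases hk : p.1 = q.u ∨ p.1 = q.g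
  · have hk' : ¬ (p.1 = q.u' ∨ p.1 = q.g') := by
      have := q.ne
      rcases hk with hk | hk <;> rw [hk] <;> tauto
    have hr := (q.lt_of_mem _ _ (q.r_mem p.1)).1
    have := key (7 * d - 1) (by
      rw [Finset.mem_erase, blockVertex, if_neg hk', Finset.mem_union, Finset.mem_erase,
        mem_apexSet hd]
      exact ⟨by omega, Or.inr ⟨(hp1 hk).symm, by omega⟩⟩)
    omega
  · obtain ⟨y, hy, hy7⟩ := q.new p.1 (fun h => hk (Or.inl h)) (fun h => hk (Or.inr h))
    have hyA := q.lt_of_mem _ _ (Finset.mem_of_mem_erase hy)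
    have := key y (by
      rw [Finset.mem_erase, Finset.mem_union]
      refine ⟨?_, Or.inl (Finset.mem_of_mem_erase hy)⟩
      unfold blockVertex
      split_ifs
      · omega
      · exact Finset.ne_of_mem_erase hy)
    omega

theorem collapsible_union_block (hd : 2 ≤ d) {i : ℕ} {D : Finset (Finset ℕ)} (hD : Collapsible D)
    (hlow : ∀ s ∈ D, Low d i s) : Collapsible (D ∪ block q d i) := by
  have hlt : ∀ k, ∀ x ∈ q.A k, x ∉ apexSet d := fun k x hx hx' => by
    have := (q.lt_of_mem k x hx).1
    have := (mem_apexSet hd).1 hx'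
    omega
  refine hD.union_image _ _ (fun p => blockVertex q p + 7 * i) (fun p => p.1) ?_ ?_ ?_ ?_
  · intro p hp
    obtain ⟨hpP, hp1, hp2⟩ := mem_blockIndex.1 hp
    refine Finset.mem_map_of_mem (shift i).toEmbedding (a := blockVertex q p) ?_
    unfold blockVertex
    split_ifs with h
    · refine Finset.mem_union_right _ (Finset.mem_erase.2 ⟨(hp2 h).symm, ?_⟩)
      rw [mem_apexSet hd]; omega
    · exact Finset.mem_union_left _ (q.r_mem _)
  · intro p hp
    rw [card_blockFace hd i (mem_blockIndex.1 hp).1]; omega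
  · exact fun p hp t ht => not_blockFace_erase_subset hd hp (hlow t ht)
  · rintro ⟨k, x⟩ hp ⟨l, y⟩ hp' hsub hne
    obtain ⟨hx, -, -⟩ := mem_blockIndex.1 hp
    obtain ⟨hy, -, hy2⟩ := mem_blockIndex.1 hp'
    rw [blockFace_erase, blockFace, Finset.map_subset_map] at hsub
    simp only at hx hy hy2 hsub
    have hyl : y ∉ q.A l ∪ (apexSet d).erase y := by
      rw [Finset.mem_union, not_or]
      exact ⟨fun h => hlt l y h hy, by simp⟩
    -- Over `u'` or `g'`, the facet without `13` still contains the whole triangle, which fixes `l`,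
    -- and then the apex part fixes `y`.
    by_cases hk : k = q.u' ∨ k = q.g'
    · exfalso
      have hv : blockVertex q (k, x) = 13 := if_pos hk
      rw [hv] at hsub
      obtain rfl : l = k := q.top k l hk fun a ha => by
        have h1 := q.lt_of_mem k a ha
        have := hsub (Finset.mem_erase.2 ⟨by omega, Finset.mem_union_left _ ha⟩)
        refine (Finset.mem_union.1 this).resolve_right fun h => hlt k a ha ?_
        exact Finset.mem_of_mem_erase h
      refine hyl (hsub (Finset.mem_erase.2 ⟨hy2 hk, Finset.mem_union_right _
        (Finset.mem_erase.2 ⟨?_, hy⟩)⟩))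
      rintro rfl
      exact hne rfl
    · have hv : blockVertex q (k, x) = q.r k := if_neg hk
      rw [hv] at hsub
      rw [not_or] at hk
      have hkl : k ≤ l := q.free k l hk.1 hk.2 fun a ha => by
        have := hsub (Finset.mem_erase.2 ⟨Finset.ne_of_mem_erase ha,
          Finset.mem_union_left _ (Finset.mem_of_mem_erase ha)⟩)
        refine (Finset.mem_union.1 this).resolve_right fun h =>
          hlt k a (Finset.mem_of_mem_erase ha) (Finset.mem_of_mem_erase h)
      refine lt_of_le_of_ne hkl fun h => ?_
      obtain rfl : k = l := Fin.ext h
      refine hyl (hsub (Finset.mem_erase.2 ⟨?_, Finset.mem_union_right _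
        (Finset.mem_erase.2 ⟨?_, hy⟩)⟩))
      · rintro rfl
        exact hlt k _ (q.r_mem k) hy
      · rintro rfl
        exact hne rfl

/-- In the joined relation exactly four simplices are not in the block. Omitting the last apex
vertex over `u`, `g` gives the open simplices of level `i`; omitting the first over `u'`, `g'` gives
those of level `i + 1`. -/
theorem relation_mem_boundarySpan_block (hd : 2 ≤ d) (i : ℕ) {c : Fin q.n → ℤ}
    (hc : ∑ k, c k • simplexBoundary (q.A k) = 0) :
    c q.u' • simplexBoundary (uSimplex d (i + 1)) + c q.g' • simplexBoundary (gSimplex d (i + 1)) +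
      (-1) ^ d • (c q.u • simplexBoundary (uSimplex d i) + c q.g • simplexBoundary (gSimplex d i)) ∈
    boundarySpan (block q d i) := by
  have hsum := sum_simplexBoundary_union_erase q.A c (apexSet d) (by norm_num) q.card_A
    (fun k a ha p hp => by
      have := q.lt_of_mem k a ha
      have := (mem_apexSet hd).1 hp
      omega) hc
  rw [← Finset.sum_product'] at hsum
  have hsum' := congrArg (chainMap (shift i)) hsum
  rw [map_sum, map_zero, ← Finset.sum_filter_add_sum_filter_not _ (fun p : Fin q.n × ℕ =>
    ((p.1 = q.u ∨ p.1 = q.g) → p.2 ≠ 7 * d - 1) ∧ ((p.1 = q.u' ∨ p.1 = q.g') → p.2 ≠ 13))] at hsum'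
  simp only [map_smul, chainMap_simplexBoundary] at hsum'
  have hmem : ∑ p ∈ blockIndex q d, (c p.1 * (-1) ^ ((apexSet d).filter (· < p.2)).card) •
      simplexBoundary ((q.A p.1 ∪ (apexSet d).erase p.2).map (shift i).toEmbedding) ∈
      boundarySpan (block q d i) :=
    sum_mem fun p hp => Submodule.smul_mem _ _
      (simplexBoundary_mem_boundarySpan (Finset.mem_image_of_mem _ hp))
  obtain ⟨h1, h2, h3, h4, h5, h6⟩ := q.ne
  have hnot : (Finset.univ ×ˢ apexSet d).filter (fun p : Fin q.n × ℕ =>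
      ¬ (((p.1 = q.u ∨ p.1 = q.g) → p.2 ≠ 7 * d - 1) ∧ ((p.1 = q.u' ∨ p.1 = q.g') → p.2 ≠ 13))) =
      {(q.u', 13), (q.g', 13), (q.u, 7 * d - 1), (q.g, 7 * d - 1)} := by
    have m1 : 13 ∈ apexSet d := by rw [mem_apexSet hd]; omega
    have m2 : 7 * d - 1 ∈ apexSet d := by rw [mem_apexSet hd]; omega
    ext ⟨k, x⟩
    simp only [Finset.mem_filter, Finset.mem_product, Finset.mem_univ, true_and,
      Finset.mem_insert, Finset.mem_singleton, Prod.mk.injEq]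
    constructor
    · rintro ⟨-, h⟩
      by_contra hcon
      apply h
      tauto
    · rintro (⟨rfl, rfl⟩ | ⟨rfl, rfl⟩ | ⟨rfl, rfl⟩ | ⟨rfl, rfl⟩) <;> tauto
  have s1 : (apexSet d).filter (· < 13) = ∅ :=
    Finset.filter_eq_empty_iff.2 fun x hx => by have := (mem_apexSet hd).1 hx; omega
  have s2 : (apexSet d).filter (· < 7 * d - 1) = apexFacet d := by
    ext x
    rw [Finset.mem_filter, mem_apexSet hd, mem_apexFacet hd]
    omega
  -- The last apex vertex is preceded by `d - 2` others, whence the sign; the first is preceded by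
  -- none.
  have hε : (-1 : ℤ) ^ (d - 2) = (-1) ^ d := by
    obtain ⟨e, rfl⟩ := Nat.exists_eq_add_of_le' hd
    simp [pow_add]
  have t1 : (q.A q.u' ∪ (apexSet d).erase 13).map (shift i).toEmbedding = uSimplex d (i + 1) := by
    rw [uSimplex, add_comm i 1, ← map_shift_shift, Finset.map_union _ (apexFacet d),
      apexSet_erase_first hd, q.A_u']
    rfl
  have t2 : (q.A q.g' ∪ (apexSet d).erase 13).map (shift i).toEmbedding = gSimplex d (i + 1) := by
    rw [gSimplex, add_comm i 1, ← map_shift_shift, Finset.map_union _ (apexFacet d),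
      apexSet_erase_first hd, q.A_g']
    rfl
  rw [hnot, Finset.sum_insert (by simp [h6, h2.symm, h4.symm]),
    Finset.sum_insert (by simp [h3.symm, h5.symm]), Finset.sum_insert (by simp [h1]),
    Finset.sum_singleton] at hsum'
  simp only [s1, s2, card_apexFacet, hε, t1, t2, apexSet_erase_last hd, q.A_u, q.A_g,
    Finset.card_empty, pow_zero, mul_one] at hsum'
  have := neg_mem hmem
  rw [blockIndex, neg_eq_of_add_eq_zero_right hsum'] at this
  convert this using 1
  simp only [uSimplex, gSimplex]
  module

end Blocks

/-! ### Stacking blocks along the binary digits -/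

section Chains

/-- A partially built complex that uses the vertices up to level `i`: the `d`-simplices in `D` have
been added, and the boundaries of the simplices in `T` are free generators modulo `∂ D`. -/
structure Stage (d i : ℕ) (D T : Finset (Finset ℕ)) : Prop where
  collapsible : Collapsible (D ∪ T)
  disjoint : Disjoint D T
  low : ∀ s ∈ D ∪ T, Low d i s
  narrow : ∀ s ∈ D ∪ T, Narrow d s

variable {d i : ℕ} {D T : Finset (Finset ℕ)}

theorem Stage.step {b : ℕ} (hd : 2 ≤ d) (h : Stage d i D T) (q : Gadget b) :
    ∃ D', D ⊆ D' ∧ Stage d (i + 1) D' T ∧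
      simplexBoundary (uSimplex d (i + 1)) - (-1 : ℤ) ^ d • ((2 : ℤ) • simplexBoundary (uSimplex d i) +
        (b : ℤ) • simplexBoundary (gSimplex d i)) ∈ boundarySpan D' ∧
      simplexBoundary (gSimplex d (i + 1)) - (-1 : ℤ) ^ d • simplexBoundary (gSimplex d i) ∈
        boundarySpan D' := by
  have hunion : D ∪ block q d i ∪ T = (D ∪ T) ∪ block q d i := Finset.union_right_comm _ _ _
  refine ⟨D ∪ block q d i, Finset.subset_union_left, ⟨?_, ?_, ?_, ?_⟩, ?_, ?_⟩
  · rw [hunion]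
    exact collapsible_union_block hd h.collapsible h.low
  · refine Finset.disjoint_union_left.2 ⟨h.disjoint, Finset.disjoint_left.2 fun s hs hsT => ?_⟩
    obtain ⟨p, hp, rfl⟩ := Finset.mem_image.1 hs
    exact not_blockFace_erase_subset hd hp (h.low _ (Finset.mem_union_right _ hsT))
      (Finset.erase_subset _ _)
  · intro s hs
    rw [hunion] at hs
    rcases Finset.mem_union.1 hs with hs | hs
    · exact (h.low s hs).mono (Nat.le_succ i)
    · exact low_of_mem_block hd hs
  · intro s hs
    rw [hunion] at hs
    rcases Finset.mem_union.1 hs with hs | hs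
    · exact h.narrow s hs
    · exact narrow_of_mem_block hd hs
  · obtain ⟨e1, e2, e3, e4⟩ := q.c₁_eq
    have := boundarySpan_mono (Finset.subset_union_right (s₁ := D))
      (relation_mem_boundarySpan_block hd i q.rel₁)
    rw [e1, e2, e3, e4] at this
    convert this using 1
    module
  · obtain ⟨e1, e2, e3, e4⟩ := q.c₂_eq
    have := boundarySpan_mono (Finset.subset_union_right (s₁ := D))
      (relation_mem_boundarySpan_block hd i q.rel₂)
    rw [e1, e2, e3, e4] at this
    convert this using 1
    module

theorem exists_of_mem_uSimplex (hd : 2 ≤ d) {x : ℕ} (hx : x ∈ uSimplex d i) :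
    ∃ y, x = y + 7 * i ∧ (y < 3 ∨ y % 7 = 6 ∧ 13 ≤ y ∧ y + 1 < 7 * d) := by
  obtain ⟨y, hy, rfl⟩ := Finset.mem_map.1 hx
  refine ⟨y, rfl, ?_⟩
  rw [Finset.mem_union, mem_apexFacet hd] at hy
  simp only [Finset.mem_insert, Finset.mem_singleton] at hy
  omega

theorem exists_of_mem_gSimplex (hd : 2 ≤ d) {x : ℕ} (hx : x ∈ gSimplex d i) :
    ∃ y, x = y + 7 * i ∧ (3 ≤ y ∧ y < 6 ∨ y % 7 = 6 ∧ 13 ≤ y ∧ y + 1 < 7 * d) := by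
  obtain ⟨y, hy, rfl⟩ := Finset.mem_map.1 hx
  refine ⟨y, rfl, ?_⟩
  rw [Finset.mem_union, mem_apexFacet hd] at hy
  simp only [Finset.mem_insert, Finset.mem_singleton] at hy
  omega

theorem low_uSimplex (hd : 2 ≤ d) : Low d i (uSimplex d i) := by
  intro x hx
  obtain ⟨y, rfl, hy⟩ := exists_of_mem_uSimplex hd hx
  omega

theorem low_gSimplex (hd : 2 ≤ d) : Low d i (gSimplex d i) := by
  intro x hx
  obtain ⟨y, rfl, hy⟩ := exists_of_mem_gSimplex hd hx
  omega

theorem narrow_uSimplex (hd : 2 ≤ d) : Narrow d (uSimplex d i) := by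
  refine ⟨?_, fun x hx y hy => ?_⟩
  · rw [uSimplex, Finset.card_map, Finset.card_union_of_disjoint, card_apexFacet]
    · rw [show ({0, 1, 2} : Finset ℕ).card = 3 from rfl]; omega
    · refine Finset.disjoint_left.2 fun x hx hx' => ?_
      rw [mem_apexFacet hd] at hx'
      simp only [Finset.mem_insert, Finset.mem_singleton] at hx
      omega
  · obtain ⟨x, rfl, hx⟩ := exists_of_mem_uSimplex hd hx
    obtain ⟨y, rfl, hy⟩ := exists_of_mem_uSimplex hd hy
    omega

theorem narrow_gSimplex (hd : 2 ≤ d) : Narrow d (gSimplex d i) := by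
  refine ⟨?_, fun x hx y hy => ?_⟩
  · rw [gSimplex, Finset.card_map, Finset.card_union_of_disjoint, card_apexFacet]
    · rw [show ({3, 4, 5} : Finset ℕ).card = 3 from rfl]; omega
    · refine Finset.disjoint_left.2 fun x hx hx' => ?_
      rw [mem_apexFacet hd] at hx'
      simp only [Finset.mem_insert, Finset.mem_singleton] at hx
      omega
  · obtain ⟨x, rfl, hx⟩ := exists_of_mem_gSimplex hd hx
    obtain ⟨y, rfl, hy⟩ := exists_of_mem_gSimplex hd hy
    omega

/-- Opens a new cyclic factor. Moving up one level makes the triangle vertices fresh, so both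
simplices have free facets. `uSimplex` is filled, setting the running multiple to `0`; `gSimplex` is
kept absent as the generator. -/
theorem Stage.start (hd : 2 ≤ d) (h : Stage d i D T) :
    Stage d (i + 1) (insert (uSimplex d (i + 1)) D) (insert (gSimplex d (i + 1)) T) ∧
      gSimplex d (i + 1) ∉ T := by
  have hu : ∀ x < 3, x + 7 * (i + 1) ∈ uSimplex d (i + 1) := fun x hx =>
    Finset.mem_map_of_mem (shift (i + 1)).toEmbedding
      (Finset.mem_union_left _ (by simp; omega))
  have hg : ∀ x, 3 ≤ x → x < 6 → x + 7 * (i + 1) ∈ gSimplex d (i + 1) := fun x hx hx' =>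
    Finset.mem_map_of_mem (shift (i + 1)).toEmbedding
      (Finset.mem_union_left _ (by simp; omega))
  have huL : ∀ t ∈ D ∪ T, ¬ (uSimplex d (i + 1)).erase (0 + 7 * (i + 1)) ⊆ t := fun t ht hsub => by
    have := h.low t ht _ (hsub (Finset.mem_erase.2 ⟨by omega, hu 1 (by omega)⟩))
    omega
  have hgL : ∀ t ∈ D ∪ T, ¬ (gSimplex d (i + 1)).erase (3 + 7 * (i + 1)) ⊆ t := fun t ht hsub => by
    have := h.low t ht _ (hsub (Finset.mem_erase.2 ⟨by omega, hg 4 (by omega) (by omega)⟩))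
    omega
  have hug : ¬ (gSimplex d (i + 1)).erase (3 + 7 * (i + 1)) ⊆ uSimplex d (i + 1) := fun hsub => by
    obtain ⟨y, hy, hy'⟩ := exists_of_mem_uSimplex hd
      (hsub (Finset.mem_erase.2 ⟨by omega, hg 4 (by omega) (by omega)⟩))
    omega
  have huT : uSimplex d (i + 1) ∉ T := fun hT =>
    huL _ (Finset.mem_union_right _ hT) (Finset.erase_subset _ _)
  have hgD : gSimplex d (i + 1) ∉ D := fun hD =>
    hgL _ (Finset.mem_union_left _ hD) (Finset.erase_subset _ _)
  have hgT : gSimplex d (i + 1) ∉ T := fun hT =>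
    hgL _ (Finset.mem_union_right _ hT) (Finset.erase_subset _ _)
  have hunion : insert (uSimplex d (i + 1)) D ∪ insert (gSimplex d (i + 1)) T =
      insert (gSimplex d (i + 1)) (insert (uSimplex d (i + 1)) (D ∪ T)) := by
    rw [Finset.insert_union, Finset.union_insert, Finset.insert_comm]
  refine ⟨⟨?_, ?_, ?_, ?_⟩, hgT⟩
  · rw [hunion]
    refine Collapsible.cons _ _ _ (Collapsible.cons _ _ _ h.collapsible (hu 0 (by omega)) ?_ huL)
      (hg 3 (by omega) (by omega)) ?_ ?_
    · rw [(narrow_uSimplex hd).1]; omega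
    · rw [(narrow_gSimplex hd).1]; omega
    · intro t ht
      rcases Finset.mem_insert.1 ht with rfl | ht
      · exact hug
      · exact hgL t ht
  · rw [Finset.disjoint_insert_left, Finset.disjoint_insert_right, Finset.mem_insert, not_or]
    exact ⟨⟨fun he => hug (he ▸ Finset.erase_subset _ _), huT⟩, hgD, h.disjoint⟩
  · intro s hs
    rw [hunion, Finset.mem_insert, Finset.mem_insert] at hs
    rcases hs with rfl | rfl | hs
    · exact low_gSimplex hd
    · exact low_uSimplex hd
    · exact (h.low s hs).mono (Nat.le_succ i)
  · intro s hs
    rw [hunion, Finset.mem_insert, Finset.mem_insert] at hs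
    rcases hs with rfl | rfl | hs
    · exact narrow_gSimplex hd
    · exact narrow_uSimplex hd
    · exact h.narrow s hs

/-- Reading the binary digits of `m`, one reaches a simplex whose boundary is `m` times that of
the generator. -/
theorem Stage.run (hd : 2 ≤ d) (h : Stage d i D T) (hu : uSimplex d i ∈ D) (m : ℕ) :
    ∃ k, 2 ^ k ≤ 2 * m + 1 ∧ ∃ D', D ⊆ D' ∧ Stage d (i + k) D' T ∧ ∃ s : ℤ, s * s = 1 ∧
      simplexBoundary (uSimplex d (i + k)) - (s * m) • simplexBoundary (gSimplex d i) ∈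
        boundarySpan D' ∧
      simplexBoundary (gSimplex d (i + k)) - s • simplexBoundary (gSimplex d i) ∈
        boundarySpan D' := by
  induction m using Nat.strong_induction_on with
  | _ m ih =>
  rcases Nat.eq_zero_or_pos m with rfl | hm
  · exact ⟨0, by norm_num, D, subset_rfl, h, 1, by norm_num,
      by simpa using simplexBoundary_mem_boundarySpan hu, by simp⟩
  · obtain ⟨k, hk, D₁, hD₁, h₁, s, hs, hu₁, hg₁⟩ := ih (m / 2) (by omega)
    obtain ⟨q⟩ : Nonempty (Gadget (m % 2)) := by
      rcases Nat.mod_two_eq_zero_or_one m with h | h <;> rw [h]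
      · exact ⟨doublingGadget⟩
      · exact ⟨doublingAddGadget⟩
    obtain ⟨D₂, hD₂, h₂, hu₂, hg₂⟩ := h₁.step hd q
    have hε : ((-1 : ℤ) ^ d) * (-1) ^ d = 1 := by rw [← mul_pow]; simp
    refine ⟨k + 1, ?_, D₂, hD₁.trans hD₂, h₂, (-1) ^ d * s, ?_, ?_, ?_⟩
    -- The `+ 1` in the bound only serves `m = 0`: for positive `k` the power is even, so `2 ^ k ≤ 2
    -- * (m / 2) ≤ m`.
    · rcases k with - | k
      · omega
      · rw [pow_succ] at hk ⊢
        omega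
    · linear_combination s * s * hε + hs
    · have e : (m : ℤ) = 2 * (m / 2 : ℕ) + (m % 2 : ℕ) := by omega
      have := add_mem hu₂ (Submodule.smul_mem _ ((-1 : ℤ) ^ d) (add_mem
        (Submodule.smul_mem _ (2 : ℤ) (boundarySpan_mono hD₂ hu₁))
        (Submodule.smul_mem _ ((m % 2 : ℕ) : ℤ) (boundarySpan_mono hD₂ hg₁))))
      convert this using 1
      rw [e]
      module
    · have := add_mem hg₂ (Submodule.smul_mem _ ((-1 : ℤ) ^ d) (boundarySpan_mono hD₂ hg₁))
      convert this using 1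
      module

/-- The closing simplices `c j` stay out of `D`, since the relation they satisfy would destroy
independence of `D ∪ T`. -/
theorem exists_stage (hd : 2 ≤ d) {ι : Type*} [DecidableEq ι] (m : ι → ℕ) (hm : ∀ j, 2 ≤ m j)
    (S : Finset ι) :
    ∃ (N : ℕ) (D : Finset (Finset ℕ)) (t c : ι → Finset ℕ),
      (N : ℝ) ≤ ∑ j ∈ S, 4 * Real.logb 2 (m j) ∧ Stage d N D (S.image t) ∧ Set.InjOn t S ∧
      ∀ j ∈ S, Narrow d (c j) ∧ Low d N (c j) ∧ ∃ s : ℤ, s * s = 1 ∧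
        simplexBoundary (c j) - (s * m j) • simplexBoundary (t j) ∈ boundarySpan D := by
  induction S using Finset.induction_on with
  | empty =>
    refine ⟨0, ∅, fun _ => ∅, fun _ => ∅, by simp, ⟨?_, ?_, ?_, ?_⟩, by simp, by simp⟩
    · simpa using Collapsible.nil
    all_goals simp
  | insert a S ha ih =>
    obtain ⟨N, D, t, c, hN, hst, hinj, hS⟩ := ih
    obtain ⟨h₁, hgT⟩ := hst.start hd
    obtain ⟨k, hk, D', hD', h₂, s, hs, hu, -⟩ := h₁.run hd (Finset.mem_insert_self _ _) (m a)
    have hDD : D ⊆ D' := (Finset.subset_insert _ _).trans hD'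
    have ht : ∀ j ∈ S, Function.update t a (gSimplex d (N + 1)) j = t j := fun j hj =>
      Function.update_of_ne (by rintro rfl; exact ha hj) _ _
    have hc : ∀ j ∈ S, Function.update c a (uSimplex d (N + 1 + k)) j = c j := fun j hj =>
      Function.update_of_ne (by rintro rfl; exact ha hj) _ _
    refine ⟨N + 1 + k, D', Function.update t a (gSimplex d (N + 1)),
      Function.update c a (uSimplex d (N + 1 + k)), ?_, ?_, ?_, ?_⟩
    · rw [Finset.sum_insert ha]
      have h2 : (2 : ℝ) ≤ m a := by exact_mod_cast hm a
      -- Since `2 * m + 1 ≤ m ^ 3` for `m ≥ 2`, the digits cost at most `3 * log m` levels; the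
      -- starting level costs at most one more `log m`, hence the factor 4.
      have hk' : (2 : ℝ) ^ k ≤ (m a : ℝ) ^ 3 := by
        have : (2 : ℝ) ^ k ≤ 2 * m a + 1 := by exact_mod_cast hk
        nlinarith [mul_nonneg (sub_nonneg.2 h2) (sub_nonneg.2 h2), mul_self_nonneg (m a : ℝ)]
      have h3 : (k : ℝ) ≤ 3 * Real.logb 2 (m a) := by
        have := Real.logb_le_logb_of_le (b := 2) (by norm_num) (by positivity) hk'
        rwa [Real.logb_pow, Real.logb_pow, Real.logb_self_eq_one (by norm_num), mul_one] at this
      have h4 : 1 ≤ Real.logb 2 (m a) := by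
        rw [Real.le_logb_iff_rpow_le (by norm_num) (by linarith)]
        simpa using h2
      push_cast
      linarith
    · rw [Finset.image_insert, Function.update_self, Finset.image_congr (g := t) ht]
      exact h₂
    · rw [Finset.coe_insert, Set.injOn_insert (by simpa using ha)]
      refine ⟨fun x hx y hy hxy => ?_, ?_⟩
      · rw [ht x hx, ht y hy] at hxy
        exact hinj hx hy hxy
      · rw [Function.update_self]
        rintro ⟨x, hx, hxe⟩
        rw [ht x hx] at hxe
        exact hgT (hxe ▸ Finset.mem_image_of_mem t hx)
    · intro j hj
      rcases Finset.mem_insert.1 hj with rfl | hj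
      · rw [Function.update_self, Function.update_self]
        exact ⟨narrow_uSimplex hd, low_uSimplex hd, s, hs, hu⟩
      · rw [ht j hj, hc j hj]
        obtain ⟨h1, h2, s, hs, h3⟩ := hS j hj
        exact ⟨h1, h2.mono (by omega), s, hs, boundarySpan_mono hDD h3⟩

end Chains

/-! ### Realization by a complex of bounded degree -/

section Realization

theorem boundaries_eq_boundarySpan {V : Type*} [LinearOrder V] (X : AbstractSimplicialComplex V)
    (k : ℕ) (F : Finset (Finset V)) (hF : X.skel (k + 1) = F) :
    X.boundaries k = boundarySpan F := by
  rw [boundaries, chains, Finsupp.supported_eq_span_single, Submodule.map_span, Set.image_image, hF,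
    boundarySpan]
  simp only [boundary_single]

theorem boundarySpan_union_image {V ι : Type*} [LinearOrder V] [Fintype ι] (D : Finset (Finset V))
    (T C : ι → Finset V) (m : ι → ℕ)
    (h : ∀ j, ∃ s : ℤ, s * s = 1 ∧
      simplexBoundary (C j) - (s * m j) • simplexBoundary (T j) ∈ boundarySpan D) :
    boundarySpan (D ∪ Finset.univ.image C) =
      boundarySpan D ⊔ Submodule.span ℤ (Set.range fun j => (m j : ℤ) • simplexBoundary (T j)) := by
  rw [boundarySpan_union]
  apply le_antisymm
  · refine sup_le le_sup_left ?_
    rw [boundarySpan, Submodule.span_le]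
    rintro _ ⟨_, hs, rfl⟩
    obtain ⟨j, -, rfl⟩ := Finset.mem_image.1 (Finset.mem_coe.1 hs)
    obtain ⟨s, -, hj⟩ := h j
    have := Submodule.add_mem_sup hj (Submodule.smul_mem _ s
      (Submodule.subset_span (s := Set.range fun j => (m j : ℤ) • simplexBoundary (T j)) ⟨j, rfl⟩))
    rwa [smul_smul, sub_add_cancel] at this
  · refine sup_le le_sup_left ?_
    rw [Submodule.span_le]
    rintro _ ⟨j, rfl⟩
    obtain ⟨s, hs, hj⟩ := h j
    have := sub_mem (Submodule.smul_mem _ s (Submodule.mem_sup_right (S := boundarySpan D)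
        (simplexBoundary_mem_boundarySpan
          (Finset.mem_image_of_mem C (Finset.mem_univ j)))))
      (Submodule.smul_mem _ s (Submodule.mem_sup_left hj))
    rwa [smul_sub, smul_smul, ← mul_assoc, hs, one_mul, sub_sub_cancel] at this

theorem boundarySpan_image_univ {V ι : Type*} [LinearOrder V] [Fintype ι] (T : ι → Finset V) :
    boundarySpan (Finset.univ.image T) =
      Submodule.span ℤ (Set.range fun j => simplexBoundary (T j)) := by
  rw [boundarySpan, Finset.coe_image, Finset.coe_univ, Set.image_univ, ← Set.range_comp]
  rfl

/-- The complex on `0, …, n - 1` whose faces of dimension less than `d` are all sets of diameter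
less than `L`, and whose `d`-dimensional faces are prescribed. -/
def windowComplex {n : ℕ} (d L : ℕ) (hd : 1 ≤ d) (hL : 1 ≤ L) (F : Finset (Finset (Fin n)))
    (hF : ∀ s ∈ F, s.card = d + 1) : AbstractSimplicialComplex (Fin n) where
  faces := {s | s.Nonempty ∧ (∀ x ∈ s, ∀ y ∈ s, (x : ℕ) < y + L) ∧ (s.card ≤ d ∨ s ∈ F)}
  isRelLowerSet_faces := by
    rintro s ⟨hs, hsL, hsF⟩
    refine ⟨hs, fun t hts ht => ⟨ht, fun x hx y hy => hsL x (hts hx) y (hts hy), ?_⟩⟩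
    rcases hsF with h | h
    · exact Or.inl ((Finset.card_le_card hts).trans h)
    · rcases eq_or_ne t s with rfl | hne
      · exact Or.inr h
      · have := Finset.card_lt_card (lt_of_le_of_ne hts hne)
        have := hF s h
        exact Or.inl (by omega)
  singleton_mem v := ⟨by simp, by simp; omega, Or.inl (by simpa using hd)⟩

section

variable {n d L : ℕ} {hd : 1 ≤ d} {hL : 1 ≤ L} {F : Finset (Finset (Fin n))}
  {hF : ∀ s ∈ F, s.card = d + 1}

theorem skel_windowComplex (hFL : ∀ s ∈ F, ∀ x ∈ s, ∀ y ∈ s, (x : ℕ) < y + L) :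
    (windowComplex d L hd hL F hF).skel d = F := by
  ext s
  constructor
  · rintro ⟨⟨-, -, h⟩, hs⟩
    exact h.resolve_left (by omega)
  · intro hs
    have hs' := hF s hs
    exact ⟨⟨Finset.card_pos.1 (by omega), hFL s hs, Or.inr hs⟩, hs'⟩

/-- A face containing `σ` lies within distance less than `L` of any vertex of `σ`, hence is a subset
of a window with at most `2 * L` vertices. -/
theorem maxDegree_windowComplex_le :
    (windowComplex d L hd hL F hF).maxDegree ≤ ((2 ^ (2 * L) : ℕ) : ℕ∞) := by
  refine iSup₂_le fun i j => iSup₂_le fun σ hσ => ?_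
  obtain ⟨⟨⟨v, hv⟩, -, -⟩, -⟩ := hσ
  let W : Finset (Fin n) := Finset.univ.filter fun x => (x : ℕ) < v + L ∧ (v : ℕ) < x + L
  have hW : W.card ≤ 2 * L := by
    have : (W.map Fin.valEmbedding).card ≤ (Finset.Ico (v + 1 - L : ℕ) (v + L)).card := by
      refine Finset.card_le_card fun x hx => ?_
      obtain ⟨y, hy, rfl⟩ := Finset.mem_map.1 hx
      have := (Finset.mem_filter.1 hy).2
      rw [Finset.mem_Ico, Fin.valEmbedding_apply]
      omega
    rw [Finset.card_map, Nat.card_Ico] at this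
    omega
  calc _ ≤ (W.powerset : Set (Finset (Fin n))).encard := Set.encard_le_encard fun τ hτ => by
        obtain ⟨⟨⟨-, hτL, -⟩, -⟩, hστ⟩ := hτ
        refine Finset.mem_coe.2 (Finset.mem_powerset.2 fun x hx => ?_)
        exact Finset.mem_filter.2
          ⟨Finset.mem_univ _, hτL x hx v (hστ hv), hτL v (hστ hv) x hx⟩
    _ = (W.powerset.card : ℕ∞) := Set.encard_coe_eq_coe_finsetCard _
    _ ≤ _ := by
        rw [Finset.card_powerset]
        exact_mod_cast Nat.pow_le_pow_right (by norm_num) hW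

end

theorem simplexBoundary_mem_cycles {V : Type*} [LinearOrder V] (X : AbstractSimplicialComplex V)
    {k : ℕ} {s : Finset V} (hs : s.card = k + 2) (h : ∀ v ∈ s, s.erase v ∈ X.faces) :
    simplexBoundary s ∈ X.cycles k := by
  refine ⟨?_, boundary_simplexBoundary s⟩
  rw [simplexBoundary_eq_sum (by omega)]
  refine sum_mem fun v hv => Finsupp.single_mem_supported ℤ _ ⟨h v hv, ?_⟩
  rw [Finset.card_erase_of_mem hv]; omega

/-- The vertices of a finite set of natural numbers that are smaller than `n`. -/
def restrictFin (n : ℕ) (s : Finset ℕ) : Finset (Fin n) :=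
  Finset.univ.filter fun x => (x : ℕ) ∈ s

theorem map_restrictFin {n : ℕ} {s : Finset ℕ} (hs : ∀ x ∈ s, x < n) :
    (restrictFin n s).map (Fin.valOrderEmb n).toEmbedding = s := by
  ext x
  simp only [restrictFin, Finset.mem_map, Finset.mem_filter, Finset.mem_univ, true_and]
  constructor
  · rintro ⟨y, hy, rfl⟩; exact hy
  · exact fun hx => ⟨⟨x, hs x hx⟩, hx, rfl⟩

theorem mem_boundarySpan_of_chainMap_mem {V W : Type*} [LinearOrder V] [LinearOrder W] (f : V ↪o W)
    {D : Finset (Finset V)} {x : Finset V →₀ ℤ}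
    (h : chainMap f x ∈ boundarySpan (D.image (Finset.map f.toEmbedding))) :
    x ∈ boundarySpan D := by
  rw [← map_chainMap_boundarySpan] at h
  obtain ⟨y, hy, hyx⟩ := h
  exact chainMap_injective f hyx ▸ hy

/-- The `d`-faces are `D` together with the closing simplices. The extra faces of lower dimension do
not affect the torsion, and they make the boundaries of the absent generators cycles of the complex.
-/
theorem exists_complex_pi_zmod {d : ℕ} (hd : 2 ≤ d) {ι : Type*} [Fintype ι] [Nonempty ι]
    (m : ι → ℕ) (hm : ∀ j, 2 ≤ m j) :
    ∃ (n : ℕ) (X : AbstractSimplicialComplex (Fin n)), X.IsOfDim d ∧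
      (n : ℝ) ≤ 7 * (∑ j, 4 * Real.logb 2 (m j) + d) ∧
      X.maxDegree ≤ ((2 ^ (2 * (7 * d)) : ℕ) : ℕ∞) ∧
      Nonempty (AddCommGroup.torsion (X.homology (d - 1)) ≃+ ∀ j, ZMod (m j)) := by
  classical
  obtain ⟨N, D, t, c, hN, hst, hinj, hS⟩ := exists_stage hd m hm Finset.univ
  set n := 7 * (N + d) with hn
  set φ := Fin.valOrderEmb n
  have hlt : ∀ s, Low d N s → ∀ x ∈ s, x < n := fun s hs x hx => by
    have := (hs x hx).2
    omega
  have hlD : ∀ s ∈ D, ((restrictFin n s).map φ.toEmbedding) = s := fun s hs =>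
    map_restrictFin (hlt s (hst.low s (Finset.mem_union_left _ hs)))
  have ht : ∀ j, t j ∈ D ∪ Finset.univ.image t := fun j =>
    Finset.mem_union_right _ (Finset.mem_image_of_mem t (Finset.mem_univ j))
  have hlt' : ∀ j, (restrictFin n (t j)).map φ.toEmbedding = t j := fun j =>
    map_restrictFin (hlt _ (hst.low _ (ht j)))
  have hlc : ∀ j, (restrictFin n (c j)).map φ.toEmbedding = c j := fun j =>
    map_restrictFin (hlt _ (hS j (Finset.mem_univ j)).2.1)
  let D' := D.image (restrictFin n)
  let T := fun j => restrictFin n (t j)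
  let C := fun j => restrictFin n (c j)
  have hD' : D'.image (Finset.map φ.toEmbedding) = D := by
    rw [Finset.image_image]
    exact (Finset.image_congr (g := id) hlD).trans Finset.image_id
  have hT' : (Finset.univ.image T).image (Finset.map φ.toEmbedding) = Finset.univ.image t := by
    rw [Finset.image_image]
    exact Finset.image_congr (g := t) fun j _ => hlt' j
  have hnarrow : ∀ s, Narrow d s → (restrictFin n s).map φ.toEmbedding = s →
      (restrictFin n s).card = d + 1 ∧
        ∀ x ∈ restrictFin n s, ∀ y ∈ restrictFin n s, (x : ℕ) < y + 7 * d := by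
    refine fun s hs he => ⟨?_, fun x hx y hy => ?_⟩
    · rw [← hs.1, ← he, Finset.card_map, he]
    · exact hs.2 _ (Finset.mem_filter.1 hx).2 _ (Finset.mem_filter.1 hy).2
  have hF : ∀ s ∈ D' ∪ Finset.univ.image C, s.card = d + 1 ∧
      ∀ x ∈ s, ∀ y ∈ s, (x : ℕ) < y + 7 * d := by
    intro s hs
    rcases Finset.mem_union.1 hs with hs | hs
    · obtain ⟨s, hsD, rfl⟩ := Finset.mem_image.1 hs
      exact hnarrow s (hst.narrow s (Finset.mem_union_left _ hsD)) (hlD s hsD)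
    · obtain ⟨j, -, rfl⟩ := Finset.mem_image.1 hs
      exact hnarrow _ (hS j (Finset.mem_univ j)).1 (hlc j)
  let X := windowComplex d (7 * d) (by omega) (by omega) (D' ∪ Finset.univ.image C)
    fun s hs => (hF s hs).1
  have hskel : X.skel d = ↑(D' ∪ Finset.univ.image C) :=
    skel_windowComplex fun s hs => (hF s hs).2
  have hdd : d - 1 + 1 = d := by omega
  -- Functionals dual to the generators, available because `D` and the generators form one
  -- collapsible family.
  choose ψ hψ using fun j => hst.collapsible.exists_functional fun s => if s = t j then 1 else 0
  have hψ' : ∀ j s, s.map φ.toEmbedding ∈ D ∪ Finset.univ.image t →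
      (ψ j ∘ₗ chainMap φ) (simplexBoundary s) =
        if s.map φ.toEmbedding = t j then 1 else 0 := by
    intro j s hs
    rw [LinearMap.comp_apply, chainMap_simplexBoundary, hψ j _ hs]
  refine ⟨n, X, ⟨?_, ?_⟩, ?_, maxDegree_windowComplex_le,
    torsion_homology_equiv X (d - 1) D' T m (fun j => by have := hm j; omega)
      (fun j => ψ j ∘ₗ chainMap φ) ?_ ?_ ?_ ?_ ?_⟩
  · rw [hskel]
    obtain ⟨j⟩ := ‹Nonempty ι›
    exact ⟨C j, Finset.mem_coe.2
      (Finset.mem_union_right _ (Finset.mem_image_of_mem C (Finset.mem_univ j)))⟩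
  · rintro s ⟨-, -, h | h⟩
    · omega
    · exact (hF s h).1.le
  · rw [hn]
    push_cast
    linarith
  · intro j s hs
    obtain ⟨s, hsD, rfl⟩ := Finset.mem_image.1 hs
    have hs' := hlD s hsD
    rw [hψ' j _ (by rw [hs']; exact Finset.mem_union_left _ hsD), hs', if_neg]
    rintro rfl
    exact Finset.disjoint_left.1 hst.disjoint hsD (Finset.mem_image_of_mem t (Finset.mem_univ j))
  · intro i j
    rw [hψ' i _ (by rw [hlt']; exact ht j), hlt']
    refine if_congr ⟨fun h => ?_, fun h => by rw [h]⟩ rfl rfl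
    exact (hinj (by simp) (by simp) h).symm
  · intro k hk x hx
    rw [← boundarySpan_image_univ, ← boundarySpan_union] at hx ⊢
    have himage : (D' ∪ Finset.univ.image T).image (Finset.map φ.toEmbedding) =
        D ∪ Finset.univ.image t := by
      rw [Finset.image_union, hD', hT']
    apply mem_boundarySpan_of_chainMap_mem φ
    rw [himage]
    apply hst.collapsible.saturated k hk
    rw [← himage, ← map_smul, ← map_chainMap_boundarySpan]
    exact Submodule.mem_map_of_mem hx
  · intro j
    obtain ⟨h1, h2⟩ := hnarrow _ (hst.narrow _ (ht j)) (hlt' j)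
    have h1 : (T j).card = d + 1 := h1
    refine simplexBoundary_mem_cycles X (by omega) fun v hv => ⟨?_, ?_, Or.inl ?_⟩
    · rw [← Finset.card_pos, Finset.card_erase_of_mem hv]; omega
    · exact fun x hx y hy => h2 x (Finset.mem_of_mem_erase hx) y (Finset.mem_of_mem_erase hy)
    · rw [Finset.card_erase_of_mem hv]; omega
  · rw [boundaries_eq_boundarySpan X (d - 1) (D' ∪ Finset.univ.image C) (by rw [hdd, hskel])]
    refine boundarySpan_union_image D' T C m fun j => ?_
    obtain ⟨s, hs, hj⟩ := (hS j (Finset.mem_univ j)).2.2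
    refine ⟨s, hs, mem_boundarySpan_of_chainMap_mem φ ?_⟩
    rw [hD', map_sub, map_smul, chainMap_simplexBoundary, chainMap_simplexBoundary, hlc, hlt']
    exact hj

theorem exists_complex_torsion {d : ℕ} (hd : 2 ≤ d) (G : Type*) [AddCommGroup G] [Finite G]
    [Nontrivial G] :
    ∃ (n : ℕ) (X : AbstractSimplicialComplex (Fin n)), X.IsOfDim d ∧
      (n : ℝ) ≤ (28 + 7 * d : ℕ) * Real.logb 2 (Nat.card G) ∧
      X.maxDegree ≤ ((2 ^ (2 * (7 * d)) : ℕ) : ℕ∞) ∧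
      Nonempty (AddCommGroup.torsion (X.homology (d - 1)) ≃+ G) := by
  classical
  obtain ⟨ι, _, m, hm, ⟨e⟩⟩ := AddCommGroup.equiv_directSum_zmod_of_finite' G
  let e' : G ≃+ ∀ j, ZMod (m j) := e.trans (DirectSum.addEquivProd _)
  -- Some factor is needed for the complex to have a `d`-face at all; this is where nontriviality of
  -- `G` enters.
  have hι : Nonempty ι := by
    by_contra h
    rw [not_nonempty_iff] at h
    exact not_subsingleton G e'.toEquiv.subsingleton
  have hcard : Nat.card G = ∏ j, m j := by
    rw [Nat.card_congr e'.toEquiv, Nat.card_pi]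
    simp
  obtain ⟨n, X, h1, h2, h3, ⟨f⟩⟩ := exists_complex_pi_zmod hd m hm
  refine ⟨n, X, h1, h2.trans ?_, h3, ⟨f.trans e'.symm⟩⟩
  have hlog : Real.logb 2 (Nat.card G) = ∑ j, Real.logb 2 (m j) := by
    rw [hcard, Nat.cast_prod, Real.logb_prod]
    intro j _
    have := hm j
    positivity
  have hone : 1 ≤ Real.logb 2 (Nat.card G) := by
    have : (2 : ℝ) ≤ Nat.card G := by exact_mod_cast Finite.one_lt_card (α := G)
    rw [Real.le_logb_iff_rpow_le (by norm_num) (by linarith)]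
    simpa using this
  rw [← Finset.mul_sum, ← hlog]
  push_cast
  -- The additive term `7 * d` is absorbed using `log |G| ≥ 1`.
  nlinarith [mul_nonneg (Nat.cast_nonneg (α := ℝ) d) (sub_nonneg.2 hone)]

end Realization

end AbstractSimplicialComplex

theorem mainTheorem4 (d : ℕ) (hd : 2 ≤ d) :
    ∃ K : ℕ, 1 ≤ K ∧
      (∀ m : ℕ, 2 ≤ m →
        ∃ (V : Type) (_ : Fintype V) (_ : LinearOrder V) (X : AbstractSimplicialComplex V),
          X.IsOfDim d ∧
          (Fintype.card V : ℝ) ≤ K * Real.logb 2 m ∧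
          X.maxDegree ≤ ((K - 1 : ℕ) : ℕ∞) ∧
          Nonempty (AddCommGroup.torsion (X.homology (d - 1)) ≃+ ZMod m)) ∧
      (∀ (G : Type*) [AddCommGroup G] [Finite G] [Nontrivial G],
        ∃ (V : Type) (_ : Fintype V) (_ : LinearOrder V) (X : AbstractSimplicialComplex V),
          X.IsOfDim d ∧
          (Fintype.card V : ℝ) ≤ K * Real.logb 2 (Nat.card G) ∧
          X.maxDegree ≤ ((K - 1 : ℕ) : ℕ∞) ∧
          Nonempty (AddCommGroup.torsion (X.homology (d - 1)) ≃+ G)) := by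
  have hdeg : 2 ^ (2 * (7 * d)) ≤ 28 + 7 * d + 2 ^ (2 * (7 * d)) - 1 := by omega
  have hcard : ∀ {n : ℕ} {x : ℝ}, 0 ≤ x → (n : ℝ) ≤ (28 + 7 * d : ℕ) * x →
      (Fintype.card (Fin n) : ℝ) ≤ (28 + 7 * d + 2 ^ (2 * (7 * d)) : ℕ) * x := by
    intro n x hx h
    rw [Fintype.card_fin]
    exact h.trans (mul_le_mul_of_nonneg_right (by exact_mod_cast Nat.le_add_right _ _) hx)
  -- The vertex constant plus the degree bound for windows of length `7 * d`.
  refine ⟨28 + 7 * d + 2 ^ (2 * (7 * d)), Nat.le_add_right_of_le (by omega), fun m hm => ?_, fun G _ _ _ => ?_⟩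
  · have : NeZero m := ⟨by omega⟩
    have : Fact (1 < m) := ⟨hm⟩
    obtain ⟨n, X, h1, h2, h3, h4⟩ := AbstractSimplicialComplex.exists_complex_torsion hd (ZMod m)
    rw [Nat.card_zmod] at h2
    exact ⟨Fin n, inferInstance, inferInstance, X, h1,
      hcard (Real.logb_nonneg (by norm_num) (by exact_mod_cast (by omega : 1 ≤ m))) h2,
      h3.trans (by exact_mod_cast hdeg), h4⟩
  · obtain ⟨n, X, h1, h2, h3, h4⟩ := AbstractSimplicialComplex.exists_complex_torsion hd G
    exact ⟨Fin n, inferInstance, inferInstance, X, h1,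
      hcard (Real.logb_nonneg (by norm_num) (by exact_mod_cast Nat.card_pos)) h2,
      h3.trans (by exact_mod_cast hdeg), h4⟩
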